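/- For an integer $N\ge 1$ let $\ell^2_N$ be $\mathbb C^N$ with its standard Hilbert space structure, and for $p\in\{1,2\}$ let $\mathcal S^p_N$ be the space $B(\ell^2_N)$ with the Schatten $p$-norm $\|X\|_p=(\sum_i s_i(X)^p)^{1/p}$, where $s_i(X)$ are the singular values of $X$. For normal operators $U_0,U_1,U_2\in B(\ell^2_N)$ with spectral decompositions $U_l=\sum_{i=1}^N z^{(l)}_iP^{(l)}_i$ (where $P^{(l)}_i$ is the orthogonal projection onto the span of the $i$-th vector of an orthonormal basis of eigenvectors of $U_l$, with eigenvalue $z^{(l)}_i$) and a function $\psi$ defined on the product of their spectra, let $$T_\psi^{U_0,U_1,U_2}(X,Y)=\sum_{i,j,k=1}^N\psi\bigl(z^{(0)}_i,z^{(1)}_k,z^{(2)}_j\bigr)P^{(0)}_iXP^{(1)}_kYP^{(2)}_j,\qquad X,Y\in B(\ell^2_N).$$ Let $h\colon\mathbb R\to\mathbb R$ be a $2\pi$-periodic $C^1$-function that is $C^2$ on $\mathbb R\setminus 2\pi\mathbb Z$ and satisfies $h(0)=0$ and $$h(x)=|x|\Bigl(\log\Bigl|\log\frac{|x|}{e}\Bigr|\Bigr)^{-1/2}\qquad\text{for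 } 0<|x|\le e^{-1}.$$ Let $\mathbb T=\{z\in\mathbb C:|z|=1\}$, let $g\colon\mathbb T\to\mathbb C$ be the function with $g(e^{i\theta})=h(\theta)$ for $\theta\in\mathbb R$, and let $f(z)=(z-1)g(z)$ for $z\in\mathbb T$; then $f\in C^2(\mathbb T)$. Let $f^{[1]}(z_0,z_1)=\frac{f(z_0)-f(z_1)}{z_0-z_1}$ if $z_0\ne z_1$ and $f^{[1]}(z_0,z_0)=f'(z_0)$; let $f^{[2]}(z_0,z_1,z_2)=\frac{f^{[1]}(z_0,z_1)-f^{[1]}(z_1,z_2)}{z_0-z_2}$ if $z_0\neq z_2$ and $f^{[2]}(z_0,z_1,z_0)=\frac{d}{dz}f^{[1]}(z,z_1)\big|_{z=z_0}$, where derivatives are taken along $\mathbb T$, i.e. $\frac{d}{dz}\varphi(z)|_{z=z_0}=\lim_{\mathbb T\ni z\to z_0}\frac{\varphi(z)-\varphi(z_0)}{z-z_0}$. Put $\varsigma(z_0,z_1,z_2)=z_1f^{[2]}(z_0,z_1,z_2)$ on $\mathbb T^3$. Then there is a constant $c>0$ such that for every $n\ge 3$ there exist unitary operators $H_n,K_n\in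 B(\ell^2_{2n+1})$ with $\sigma(H_n)=\sigma(K_n)$ and $$\bigl\|T_\varsigma^{K_n,H_n,H_n}\colon\mathcal S^2_{2n+1}\times\mathcal S^2_{2n+1}\to\mathcal S^1_{2n+1}\bigr\|\ \ge\ c\,(\log n)^{1/2},$$ where the norm is the supremum of $\|T_\varsigma^{K_n,H_n,H_n}(X,Y)\|_1$ over all $X,Y$ with $\|X\|_2\le1$ and $\|Y\|_2\le 1$. -/

import Mathlib

open scoped ENNReal

noncomputable section

namespace TripleOperatorIntegral

/-- The Hilbert space `ℓ²_N`. -/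
abbrev Ell2 (N : ℕ) : Type := EuclideanSpace ℂ (Fin N)

/-- The algebra `B(ℓ²_N)` of operators on `ℓ²_N`. -/
abbrev Op (N : ℕ) : Type := Ell2 N →L[ℂ] Ell2 N

/-- The Schatten `p`-norm (`1 ≤ p < ∞`): the `ℓ^p`-norm of the sequence of singular values. -/
def schattenNorm {N : ℕ} (p : ℝ) (X : Op N) : ℝ :=
  (∑ i ∈ Finset.range N, (X.toLinearMap.singularValues i) ^ p) ^ (1 / p)

/-- The set of eigenvalues of an operator on `ℓ²_N`, as a type. -/
abbrev Eig {N : ℕ} (U : Op N) : Type := Module.End.Eigenvalues U.toLinearMap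

/-- The spectral projection of a normal operator at `z`, that is, the orthogonal projection
onto the eigenspace of `z`. -/
def spectralProj {N : ℕ} (U : Op N) (z : ℂ) : Op N :=
  (Module.End.eigenspace U.toLinearMap z).starProjection

/-- The triple operator integral `T_ψ^{U₀,U₁,U₂}(X, Y)` of normal operators `U₀, U₁, U₂`:
`∑ ψ(z₀,z₁,z₂) E₀(z₀) X E₁(z₁) Y E₂(z₂)`, over the eigenvalues `zᵢ` of `Uᵢ`, where `Eᵢ` are the
spectral projections. See `triple_eq_sum_of_eigenbasis` for the form that uses orthonormal bases
of eigenvectors. -/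
def triple {N : ℕ} (ψ : ℂ → ℂ → ℂ → ℂ) (U₀ U₁ U₂ : Op N) (X Y : Op N) : Op N :=
  ∑ z₀ : Eig U₀, ∑ z₁ : Eig U₁, ∑ z₂ : Eig U₂,
    ψ z₀.val z₁.val z₂.val •
      (spectralProj U₀ z₀.val * X * spectralProj U₁ z₁.val * Y * spectralProj U₂ z₂.val)

/-- The norm of a (bilinear) map `S²_N × S²_N → S¹_N`: the supremum of `‖B(X, Y)‖₁` over
`‖X‖₂ ≤ 1` and `‖Y‖₂ ≤ 1`. -/
def bilinNorm {N : ℕ} (B : Op N → Op N → Op N) : ℝ≥0∞ :=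
  ⨆ (X : Op N) (Y : Op N) (_ : schattenNorm 2 X ≤ 1) (_ : schattenNorm 2 Y ≤ 1),
    ENNReal.ofReal (schattenNorm 1 (B X Y))

/-- The unit circle `𝕋 ⊆ ℂ`. Functions on `𝕋` are functions on `ℂ` of which only the values
on `𝕋` matter, and `d/dz` on `𝕋` is `derivWithin · 𝕋`. -/
def circle : Set ℂ := Metric.sphere 0 1

open Classical in
/-- The divided difference of first order of a function on `𝕋`. -/
def divDiff₁ (f : ℂ → ℂ) (z₀ z₁ : ℂ) : ℂ :=
  if z₀ ≠ z₁ then (f z₀ - f z₁) / (z₀ - z₁) else derivWithin f circle z₀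

open Classical in
/-- The divided difference of second order of a function on `𝕋`. -/
def divDiff₂ (f : ℂ → ℂ) (z₀ z₁ z₂ : ℂ) : ℂ :=
  if z₀ ≠ z₂ then (divDiff₁ f z₀ z₁ - divDiff₁ f z₁ z₂) / (z₀ - z₂)
  else derivWithin (fun z => divDiff₁ f z z₁) circle z₀

open Classical in
/-- `|x| (log |log (|x| / e)|)^{-1/2}`, and `0` at `x = 0`. -/
def hFormula (x : ℝ) : ℝ :=
  if x = 0 then 0
  else |x| * (Real.log |Real.log (|x| / Real.exp 1)|) ^ (-(1 / 2) : ℝ)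

/-- `h` is a `2π`-periodic `C¹` function on `ℝ` that extends `hFormula` from `[-e⁻¹, e⁻¹]` and
is `C²` away from the singular points `2πk`, `k ∈ ℤ`. -/
structure IsPeriodicExtension (h : ℝ → ℝ) : Prop where
  eq_formula : ∀ x ∈ Set.Icc (-(Real.exp 1)⁻¹) (Real.exp 1)⁻¹, h x = hFormula x
  periodic : Function.Periodic h (2 * Real.pi)
  contDiff : ContDiff ℝ 1 h
  contDiffOn : ContDiffOn ℝ 2 h {x | ∀ k : ℤ, x ≠ 2 * Real.pi * k}

/-- The function `g` on `𝕋` with `g(e^{iθ}) = h(θ)`. -/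
def gFun (h : ℝ → ℝ) (z : ℂ) : ℂ := (h z.arg : ℂ)

/-- The function `f(z) = (z - 1) g(z)` on `𝕋`. -/
def fFun (h : ℝ → ℝ) (z : ℂ) : ℂ := (z - 1) * gFun h z

/-- The function `ς(z₀, z₁, z₂) = z₁ f^{[2]}(z₀, z₁, z₂)` on `𝕋³`. -/
def sigmaFun (h : ℝ → ℝ) (z₀ z₁ z₂ : ℂ) : ℂ := z₁ * divDiff₂ (fFun h) z₀ z₁ z₂

theorem gFun_exp {h : ℝ → ℝ} (hp : Function.Periodic h (2 * Real.pi)) (θ : ℝ) :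
    gFun h (Complex.exp (θ * Complex.I)) = (h θ : ℂ) := by
  unfold gFun
  rw [Complex.arg_exp_mul_I]
  congr 1
  rw [toIocMod]
  exact hp.sub_zsmul_eq _

/-- Spectral projections in terms of an orthonormal basis of eigenvectors. -/
theorem spectralProj_eq_sum {N : ℕ} (U : Op N) (b : OrthonormalBasis (Fin N) ℂ (Ell2 N))
    (z : Fin N → ℂ) (hb : ∀ i, U (b i) = z i • b i) (w : ℂ) :
    spectralProj U w = ∑ i with z i = w, (ℂ ∙ b i).starProjection := by
  have key : ∀ j, spectralProj U w (b j) =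
      (∑ i with z i = w, (ℂ ∙ b i).starProjection) (b j) := by
    intro j
    have h1 : ∀ i, (ℂ ∙ b i).starProjection (b j) = if i = j then b j else 0 := by
      intro i
      rw [Submodule.starProjection_unit_singleton ℂ (b.norm_eq_one i)]
      rw [b.inner_eq_ite]
      split_ifs with hij
      · simp [hij]
      · simp
    rw [sum_apply]
    simp only [h1]
    rw [Finset.sum_ite_eq' _ j]
    simp only [Finset.mem_filter, Finset.mem_univ, true_and]
    split_ifs with hj
    · refine Submodule.starProjection_eq_self_iff.2 ?_
      rw [Module.End.mem_eigenspace_iff, ← hj]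
      exact hb j
    · refine (Submodule.starProjection_apply_eq_zero_iff _).2 ?_
      rw [Submodule.mem_orthogonal]
      intro v hv
      have hv' : U v = w • v := Module.End.mem_eigenspace_iff.1 hv
      have h2 : b.repr (U v) j = z j * b.repr v j := by
        conv_lhs => rw [← b.sum_repr v]
        simp [map_sum, hb, b.repr_self, Pi.single_apply, mul_comm]
      rw [hv'] at h2
      have h3 : b.repr v j = 0 := by
        by_contra h0
        apply hj
        have : w * b.repr v j = z j * b.repr v j := by simpa using h2
        exact (mul_right_cancel₀ h0 this).symm
      rw [b.repr_apply_apply] at h3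
      exact inner_eq_zero_symm.1 h3
  ext1 v
  rw [← b.sum_repr v, map_sum, map_sum]
  exact Finset.sum_congr rfl fun j _ => by rw [map_smul, map_smul, key j]

theorem sum_eig_eq_sum {N : ℕ} (U : Op N) (b : OrthonormalBasis (Fin N) ℂ (Ell2 N))
    (z : Fin N → ℂ) (hb : ∀ i, U (b i) = z i • b i) (F : ℂ → Op N → Op N)
    (hF : ∀ w (s : Finset (Fin N)) (P : Fin N → Op N), F w (∑ i ∈ s, P i) = ∑ i ∈ s, F w (P i)) :
    ∑ w : Eig U, F w.val (spectralProj U w.val) = ∑ i, F (z i) (ℂ ∙ b i).starProjection := by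
  have he : ∀ i, Module.End.HasEigenvalue U.toLinearMap (z i) := fun i =>
    Module.End.hasEigenvalue_of_hasEigenvector
      ⟨Module.End.mem_eigenspace_iff.2 (hb i), b.orthonormal.ne_zero i⟩
  let e : Fin N → Eig U := fun i => ⟨z i, he i⟩
  classical
  rw [← Finset.sum_fiberwise Finset.univ e fun i => F (z i) (ℂ ∙ b i).starProjection]
  refine Finset.sum_congr rfl fun w _ => ?_
  rw [spectralProj_eq_sum U b z hb, hF]
  refine Finset.sum_congr ?_ fun i hi => ?_
  · ext i
    simp only [Finset.mem_filter, Finset.mem_univ, true_and]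
    exact ⟨fun h => Subtype.ext h, fun h => congrArg Subtype.val h⟩
  · have hw : e i = w := (Finset.mem_filter.1 hi).2
    subst hw
    rfl

/-- For any orthonormal bases of eigenvectors of `U₀, U₁, U₂`, with eigenvalues `zᵢ⁽⁰⁾, zₖ⁽¹⁾, zⱼ⁽²⁾`
and rank one projections `Pᵢ⁽⁰⁾, Pₖ⁽¹⁾, Pⱼ⁽²⁾`, the triple operator integral is
`∑ ψ(zᵢ⁽⁰⁾, zₖ⁽¹⁾, zⱼ⁽²⁾) Pᵢ⁽⁰⁾ X Pₖ⁽¹⁾ Y Pⱼ⁽²⁾`. -/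
theorem triple_eq_sum_of_eigenbasis {N : ℕ} (ψ : ℂ → ℂ → ℂ → ℂ) (U₀ U₁ U₂ X Y : Op N)
    (b₀ b₁ b₂ : OrthonormalBasis (Fin N) ℂ (Ell2 N)) (z₀ z₁ z₂ : Fin N → ℂ)
    (h₀ : ∀ i, U₀ (b₀ i) = z₀ i • b₀ i) (h₁ : ∀ k, U₁ (b₁ k) = z₁ k • b₁ k)
    (h₂ : ∀ j, U₂ (b₂ j) = z₂ j • b₂ j) :
    triple ψ U₀ U₁ U₂ X Y = ∑ i, ∑ k, ∑ j, ψ (z₀ i) (z₁ k) (z₂ j) •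
      ((ℂ ∙ b₀ i).starProjection * X * (ℂ ∙ b₁ k).starProjection * Y *
        (ℂ ∙ b₂ j).starProjection) := by
  unfold triple
  rw [sum_eig_eq_sum U₀ b₀ z₀ h₀ fun w P => ∑ v₁ : Eig U₁, ∑ v₂ : Eig U₂,
    ψ w v₁.val v₂.val • (P * X * spectralProj U₁ v₁.val * Y * spectralProj U₂ v₂.val)]
  · refine Finset.sum_congr rfl fun i _ => ?_
    rw [sum_eig_eq_sum U₁ b₁ z₁ h₁ fun w P => ∑ v₂ : Eig U₂,
      ψ (z₀ i) w v₂.val • ((ℂ ∙ b₀ i).starProjection * X * P * Y * spectralProj U₂ v₂.val)]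
    · refine Finset.sum_congr rfl fun k _ => ?_
      rw [sum_eig_eq_sum U₂ b₂ z₂ h₂ fun w P => ψ (z₀ i) (z₁ k) w •
        ((ℂ ∙ b₀ i).starProjection * X * (ℂ ∙ b₁ k).starProjection * Y * P)]
      intro w s P
      simp only [Finset.mul_sum, Finset.smul_sum]
    · intro w s P
      simp only [Finset.mul_sum, Finset.sum_mul, Finset.smul_sum]
      exact Finset.sum_comm
  · intro w s P
    simp only [Finset.sum_mul, Finset.smul_sum]
    exact (Finset.sum_congr rfl fun v _ => Finset.sum_comm).trans Finset.sum_comm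

end TripleOperatorIntegral

end

noncomputable section

namespace TripleOperatorIntegral


/-- Every operator has an orthonormal basis of right singular vectors. -/
theorem exists_rightSingularBasis {N : ℕ} (Z : Op N) :
    ∃ v : OrthonormalBasis (Fin N) ℂ (Ell2 N),
      ∀ i : Fin N, ‖Z (v i)‖ = Z.toLinearMap.singularValues i := by
  have hN : Module.finrank ℂ (Ell2 N) = N := finrank_euclideanSpace_fin
  have hs := Z.toLinearMap.isSymmetric_adjoint_comp_self
  refine ⟨hs.eigenvectorBasis hN, fun i => ?_⟩
  have h1 := hs.apply_eigenvectorBasis hN i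
  set v := hs.eigenvectorBasis hN i with hv
  have hn : ‖v‖ = 1 := (hs.eigenvectorBasis hN).norm_eq_one i
  have h2 : inner ℂ (Z v) (Z v) = ((hs.eigenvalues hN i : ℝ) : ℂ) := by
    have h3 : inner ℂ v ((Z.toLinearMap.adjoint ∘ₗ Z.toLinearMap) v) = inner ℂ (Z v) (Z v) := by
      rw [LinearMap.comp_apply, LinearMap.adjoint_inner_right]
      rfl
    rw [← h3, h1, inner_smul_right, inner_self_eq_norm_sq_to_K, hn]
    simp
  rw [inner_self_eq_norm_sq_to_K] at h2
  have h4 : ‖Z v‖ ^ 2 = Z.toLinearMap.singularValues i ^ 2 := by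
    rw [Z.toLinearMap.sq_singularValues_fin hN]
    exact Complex.ofReal_injective (by push_cast; exact h2)
  exact (pow_left_inj₀ (norm_nonneg _) (Z.toLinearMap.singularValues_nonneg _) two_ne_zero).1 h4

/-- The Hilbert–Schmidt norm of a rank one operator. -/
theorem schattenNorm_two_rankOne {N : ℕ} (x y : Ell2 N) :
    schattenNorm 2 (InnerProductSpace.rankOne ℂ x y) = ‖x‖ * ‖y‖ := by
  obtain ⟨v, hv⟩ := exists_rightSingularBasis (InnerProductSpace.rankOne ℂ x y)
  unfold schattenNorm
  rw [Finset.sum_range fun i => (LinearMap.singularValues _ i : ℝ) ^ (2 : ℝ)]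
  have h1 : ∑ i : Fin N,
      ((InnerProductSpace.rankOne ℂ x y).toLinearMap.singularValues i : ℝ) ^ (2 : ℝ) =
      (‖x‖ * ‖y‖) ^ 2 := by
    calc _ = ∑ i, ‖x‖ ^ 2 * ‖inner ℂ y (v i)‖ ^ 2 := by
          refine Finset.sum_congr rfl fun i _ => ?_
          rw [← hv i, Real.rpow_two, InnerProductSpace.rankOne_apply, norm_smul]
          ring
      _ = _ := by
          rw [← Finset.mul_sum, v.sum_sq_norm_inner_left, mul_pow]
  rw [h1, ← Real.sqrt_eq_rpow, Real.sqrt_sq (by positivity)]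

/-- Trace duality: the trace norm dominates the pairing with a contraction given by its
singular value decomposition. -/
theorem norm_sum_inner_le_schattenNorm_one {N : ℕ} {ι : Type*} [Fintype ι] (Z : Op N)
    (a b : ι → Ell2 N) (ha : Orthonormal ℂ a) (hb : Orthonormal ℂ b) (D : ι → ℂ)
    (hD : ∀ l, ‖D l‖ ≤ 1) :
    ‖∑ l, D l * inner ℂ (a l) (Z (b l))‖ ≤ schattenNorm 1 Z := by
  obtain ⟨v, hv⟩ := exists_rightSingularBasis Z
  have h1 : ∑ l, D l * inner ℂ (a l) (Z (b l)) =
      ∑ i, ∑ l, D l * inner ℂ (v i) (b l) * inner ℂ (a l) (Z (v i)) := by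
    rw [Finset.sum_comm]
    refine Finset.sum_congr rfl fun l _ => ?_
    conv_lhs => rw [← v.sum_repr' (b l)]
    rw [map_sum, inner_sum, Finset.mul_sum]
    refine Finset.sum_congr rfl fun i _ => ?_
    rw [map_smul, inner_smul_right, mul_assoc]
  unfold schattenNorm
  rw [Finset.sum_range fun i => (LinearMap.singularValues _ i : ℝ) ^ (1 : ℝ), h1]
  simp only [Real.rpow_one, div_one]
  refine (norm_sum_le _ _).trans (Finset.sum_le_sum fun i _ => ?_)
  rw [← hv i]
  calc ‖∑ l, D l * inner ℂ (v i) (b l) * inner ℂ (a l) (Z (v i))‖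
      ≤ ∑ l, ‖inner ℂ (b l) (v i)‖ * ‖inner ℂ (a l) (Z (v i))‖ := by
        refine (norm_sum_le _ _).trans (Finset.sum_le_sum fun l _ => ?_)
        rw [norm_mul, norm_mul, norm_inner_symm (b l)]
        refine mul_le_mul_of_nonneg_right ?_ (norm_nonneg _)
        exact mul_le_of_le_one_left (norm_nonneg _) (hD l)
    _ ≤ √(∑ l, ‖inner ℂ (b l) (v i)‖ ^ 2) * √(∑ l, ‖inner ℂ (a l) (Z (v i))‖ ^ 2) :=
        Real.sum_mul_le_sqrt_mul_sqrt _ _ _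
    _ ≤ √(‖v i‖ ^ 2) * √(‖Z (v i)‖ ^ 2) := by
        gcongr
        · exact hb.sum_inner_products_le _
        · exact ha.sum_inner_products_le _
    _ = ‖Z (v i)‖ := by
        rw [Real.sqrt_sq (norm_nonneg _), Real.sqrt_sq (norm_nonneg _), v.norm_eq_one, one_mul]

/-- The matrix entries of a triple operator integral whose arguments are rank one operators
through a common eigenvector of the middle operator. -/
theorem inner_triple_rankOne {N : ℕ} (ψ : ℂ → ℂ → ℂ → ℂ) (U : Op N)
    (b : OrthonormalBasis (Fin N) ℂ (Ell2 N)) (z : Fin N → ℂ) (hb : ∀ i, U (b i) = z i • b i)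
    (x y : Ell2 N) (o p q : Fin N) :
    inner ℂ (b p) (triple ψ U U U (InnerProductSpace.rankOne ℂ x (b o))
      (InnerProductSpace.rankOne ℂ (b o) y) (b q)) =
      ψ (z p) (z o) (z q) * (inner ℂ (b p) x * inner ℂ y (b q)) := by
  classical
  rw [triple_eq_sum_of_eigenbasis ψ U U U _ _ b b b z z z hb hb hb]
  have hP : ∀ i j, (ℂ ∙ b i).starProjection (b j) = if i = j then b j else 0 := by
    intro i j
    rw [Submodule.starProjection_unit_singleton ℂ (b.norm_eq_one i), b.inner_eq_ite]
    split_ifs with hij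
    · simp [hij]
    · simp
  have hx : ∀ i, inner ℂ (b p) ((ℂ ∙ b i).starProjection x) =
      if i = p then inner ℂ (b p) x else 0 := by
    intro i
    rw [Submodule.starProjection_unit_singleton ℂ (b.norm_eq_one i), inner_smul_right,
      b.inner_eq_ite]
    rcases eq_or_ne i p with rfl | hip
    · simp
    · simp [hip, hip.symm]
  have hterm : ∀ i k j, inner ℂ (b p) ((ψ (z i) (z k) (z j) •
      ((ℂ ∙ b i).starProjection * InnerProductSpace.rankOne ℂ x (b o) *
        (ℂ ∙ b k).starProjection * InnerProductSpace.rankOne ℂ (b o) y *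
        (ℂ ∙ b j).starProjection)) (b q)) =
      if j = q then if k = o then if i = p then
        ψ (z i) (z k) (z j) * (inner ℂ (b p) x * inner ℂ y (b q)) else 0 else 0 else 0 := by
    intro i k j
    simp only [smul_apply, mul_apply_eq_comp, hP j q]
    rcases eq_or_ne j q with rfl | hj
    · rcases eq_or_ne k o with rfl | hk
      · simp [hP, hx, mul_comm]
      · simp [hP, hk]
    · simp [hj]
  simp only [sum_apply, inner_sum, hterm]
  simp


theorem exp_mul_I_sub_exp_mul_I (s t : ℝ) :
    Complex.exp (s * Complex.I) - Complex.exp (t * Complex.I) =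
      Complex.exp (((s + t) / 2 : ℝ) * Complex.I) *
        (2 * Complex.I * (Real.sin ((s - t) / 2) : ℂ)) := by
  rw [Complex.ofReal_sin, Complex.sin]
  have h1 : (s : ℂ) * Complex.I = ((s + t) / 2 : ℝ) * Complex.I +
      ((s - t) / 2 : ℝ) * Complex.I := by push_cast; ring
  have h2 : (t : ℂ) * Complex.I = ((s + t) / 2 : ℝ) * Complex.I +
      -((s - t) / 2 : ℝ) * Complex.I := by push_cast; ring
  rw [h1, h2, Complex.exp_add, Complex.exp_add]
  linear_combination (Complex.exp (((s + t) / 2 : ℝ) * Complex.I) *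
    (Complex.exp (((s - t) / 2 : ℝ) * Complex.I) -
      Complex.exp (-((s - t) / 2 : ℝ) * Complex.I))) * Complex.I_sq

theorem exp_mul_I_ne_exp_mul_I {s t : ℝ} (h : Real.sin ((s - t) / 2) ≠ 0) :
    Complex.exp (s * Complex.I) ≠ Complex.exp (t * Complex.I) := by
  rw [← sub_ne_zero, exp_mul_I_sub_exp_mul_I]
  exact mul_ne_zero (Complex.exp_ne_zero _)
    (mul_ne_zero (by simp) (Complex.ofReal_ne_zero.2 h))

/-- At `z₁ = 1`, `ς` is the divided difference of `g`. -/
theorem sigmaFun_one {h : ℝ → ℝ} (z w : ℂ) (hz : z ≠ 1) (hw : w ≠ 1) (hzw : z ≠ w) :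
    sigmaFun h z 1 w = (gFun h z - gFun h w) / (z - w) := by
  have hz' : z - 1 ≠ 0 := sub_ne_zero.2 hz
  have hw' : 1 - w ≠ 0 := sub_ne_zero.2 hw.symm
  have h1 : divDiff₁ (fFun h) z 1 = gFun h z := by
    simp only [divDiff₁, if_pos hz, fFun, sub_self, zero_mul, sub_zero]
    field_simp
  have h2 : divDiff₁ (fFun h) 1 w = gFun h w := by
    simp only [divDiff₁, if_pos hw.symm, fFun, sub_self, zero_mul, zero_sub]
    rw [div_eq_iff hw']
    ring
  rw [sigmaFun, divDiff₂, if_pos hzw, h1, h2, one_mul]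

theorem sigmaFun_exp_one_exp {h : ℝ → ℝ} (hp : Function.Periodic h (2 * Real.pi)) {s t : ℝ}
    (hs : Real.sin (s / 2) ≠ 0) (ht : Real.sin (t / 2) ≠ 0) (hst : Real.sin ((s - t) / 2) ≠ 0) :
    sigmaFun h (Complex.exp (s * Complex.I)) 1 (Complex.exp (t * Complex.I)) =
      ((h s - h t : ℝ) : ℂ) / (Complex.exp (((s + t) / 2 : ℝ) * Complex.I) *
        (2 * Complex.I * (Real.sin ((s - t) / 2) : ℂ))) := by
  have e1 : ∀ {u : ℝ}, Real.sin (u / 2) ≠ 0 → Complex.exp (u * Complex.I) ≠ 1 := by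
    intro u hu
    have := exp_mul_I_ne_exp_mul_I (s := u) (t := 0) (by simpa using hu)
    simpa using this
  rw [sigmaFun_one _ _ (e1 hs) (e1 ht) (exp_mul_I_ne_exp_mul_I hst), gFun_exp hp, gFun_exp hp,
    exp_mul_I_sub_exp_mul_I]
  push_cast
  rfl

/-- The arguments `e^{-(j+1)}` of the eigenvalues. -/
def node (j : ℕ) : ℝ := Real.exp (-(j + 1))

/-- The slope of `h` at the `j`-th node. -/
def slope (j : ℕ) : ℝ := (Real.log (j + 2)) ^ (-(1 / 2) : ℝ)

theorem node_pos (j : ℕ) : 0 < node j := Real.exp_pos _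

theorem node_le (j : ℕ) : node j ≤ (Real.exp 1)⁻¹ := by
  rw [node, ← Real.exp_neg, Real.exp_le_exp]
  have : (0 : ℝ) ≤ j := Nat.cast_nonneg j
  linarith

theorem node_lt_one (j : ℕ) : node j < 1 := by
  rw [node, Real.exp_lt_one_iff]
  have : (0 : ℝ) ≤ j := Nat.cast_nonneg j
  linarith

theorem two_mul_node_le {j k : ℕ} (hjk : j < k) : 2 * node k ≤ node j := by
  have h1 : node k ≤ node j * Real.exp (-1) := by
    rw [node, node, ← Real.exp_add, Real.exp_le_exp]
    have : (j : ℝ) + 1 ≤ k := by exact_mod_cast hjk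
    linarith
  have h2 : 2 * Real.exp (-1) ≤ 1 := by
    rw [Real.exp_neg, ← div_eq_mul_inv, div_le_one (Real.exp_pos _)]
    have := Real.add_one_le_exp (1 : ℝ)
    linarith
  nlinarith [node_pos j]

theorem slope_pos (j : ℕ) : 0 < slope j := by
  refine Real.rpow_pos_of_pos (Real.log_pos ?_) _
  have : (0 : ℝ) ≤ j := Nat.cast_nonneg j
  linarith

theorem slope_antitone : Antitone slope := by
  intro j k hjk
  have h0 : (0 : ℝ) ≤ j := Nat.cast_nonneg j
  have h1 : (j : ℝ) ≤ k := by exact_mod_cast hjk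
  refine Real.rpow_le_rpow_of_nonpos (Real.log_pos (by linarith)) ?_ (by norm_num)
  exact Real.log_le_log (by linarith) (by linarith)

theorem apply_of_abs_eq_node {h : ℝ → ℝ} (hh : IsPeriodicExtension h) (j : ℕ) {x : ℝ}
    (hx : |x| = node j) : h x = node j * slope j := by
  have hx0 : x ≠ 0 := abs_pos.1 (hx ▸ node_pos j)
  rw [hh.eq_formula x (abs_le.1 (hx ▸ node_le j)), hFormula, if_neg hx0, hx, slope]
  congr 3
  rw [node, ← Real.exp_sub, Real.log_exp]
  have h0 : (0 : ℝ) ≤ j := Nat.cast_nonneg j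
  rw [abs_of_nonpos (by linarith)]
  ring

/-- Lower bound for the divided differences of `h` between `node j` and `-node k`. -/
theorem slope_div_three_le {j k n : ℕ} (hjk : j < k) (hj : j ≤ n) :
    slope n / 3 ≤ (node j * slope j - node k * slope k) / (node j + node k) := by
  have p1 := node_pos j
  have p2 := node_pos k
  rw [le_div_iff₀ (by positivity)]
  have h1 := two_mul_node_le hjk
  have h2 := slope_antitone hjk.le
  have h3 := slope_antitone hj
  have h4 := slope_pos n
  have h5 : node k * slope k ≤ node k * slope j := by gcongr
  have h6 : (node j + node k) / 3 * slope n ≤ (node j - node k) * slope j := by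
    apply mul_le_mul _ h3 h4.le <;> linarith
  linarith

theorem log_le_sum_inv_abs_sub {n j : ℕ} (hj : j < n) :
    Real.log n ≤ ∑ k ∈ Finset.range n, |(k : ℝ) - j|⁻¹ := by
  obtain ⟨m, rfl⟩ := Nat.exists_eq_add_of_lt hj
  have hH : ∀ r : ℕ, Real.log (r + 1) ≤ ∑ i ∈ Finset.range r, ((i : ℝ) + 1)⁻¹ := by
    intro r
    have := log_add_one_le_harmonic r
    simpa [harmonic] using this
  have e : j + m + 1 = j + 1 + m := by ring
  rw [e, Finset.sum_range_add, Finset.sum_range_succ]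
  have h1 : ∑ k ∈ Finset.range j, |(k : ℝ) - j|⁻¹ = ∑ i ∈ Finset.range j, ((i : ℝ) + 1)⁻¹ := by
    rw [← Finset.sum_range_reflect]
    refine Finset.sum_congr rfl fun i hi => ?_
    have hi' : i + 1 ≤ j := Finset.mem_range.1 hi
    have e1 : j - 1 - i = j - (i + 1) := by omega
    have h0 : (0 : ℝ) ≤ i := Nat.cast_nonneg i
    rw [e1, Nat.cast_sub hi']
    push_cast
    rw [abs_of_nonpos (by linarith)]
    ring
  have h2 : ∑ i ∈ Finset.range m, |((j + 1 + i : ℕ) : ℝ) - j|⁻¹ =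
      ∑ i ∈ Finset.range m, ((i : ℝ) + 1)⁻¹ := by
    refine Finset.sum_congr rfl fun i _ => ?_
    have h0 : (0 : ℝ) ≤ i := Nat.cast_nonneg i
    push_cast
    rw [abs_of_nonneg (by linarith)]
    ring
  rw [h1, h2]
  have h3 : Real.log ((j + 1 + m : ℕ) : ℝ) ≤ Real.log (j + 1) + Real.log (m + 1) := by
    rw [← Real.log_mul (by positivity) (by positivity)]
    refine Real.log_le_log (by positivity) ?_
    push_cast
    nlinarith [mul_nonneg (Nat.cast_nonneg (α := ℝ) j) (Nat.cast_nonneg (α := ℝ) m)]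
  have := hH j
  have := hH m
  simp only [sub_self, abs_zero, inv_zero, add_zero]
  linarith

/-- The terms of the trace pairing in the lower bound for the norm. -/
def pairingTerm (n j k : ℕ) : ℝ :=
  1 / (n : ℝ) ^ 2 * ((node j * slope j - node k * slope k) /
    (2 * Real.sin ((node j + node k) / 2) * Real.sin (Real.pi * (k - j) / n)))

theorem pairingTerm_symm (n j k : ℕ) : pairingTerm n j k = pairingTerm n k j := by
  have e : Real.sin (Real.pi * (k - j) / n) = -Real.sin (Real.pi * (j - k) / n) := by
    rw [← Real.sin_neg]
    congr 1
    ring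
  rw [pairingTerm, pairingTerm, e, add_comm (node k), mul_neg, div_neg, ← neg_div, neg_sub]

theorem sin_pi_mul_div_pos {n j k : ℕ} (hjk : j < k) (hk : k < n) :
    0 < Real.sin (Real.pi * (k - j) / n) := by
  have hn : (0 : ℝ) < n := by exact_mod_cast (Nat.zero_le k).trans_lt hk
  have h1 : (j : ℝ) < k := by exact_mod_cast hjk
  have h2 : (k : ℝ) < n := by exact_mod_cast hk
  have h0 : (0 : ℝ) ≤ j := Nat.cast_nonneg j
  refine Real.sin_pos_of_pos_of_lt_pi (div_pos (mul_pos Real.pi_pos (by linarith)) hn) ?_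
  rw [div_lt_iff₀ hn]
  exact mul_lt_mul_of_pos_left (by linarith) Real.pi_pos

theorem sin_node_add_node_pos (j k : ℕ) : 0 < Real.sin ((node j + node k) / 2) := by
  refine Real.sin_pos_of_pos_of_lt_pi ?_ ?_
  · linarith [node_pos j, node_pos k]
  · linarith [node_lt_one j, node_lt_one k, Real.pi_gt_three]

theorem le_pairingTerm {n j k : ℕ} (hj : j < n) (hk : k < n) :
    slope (n - 1) / (3 * Real.pi * n) * |(k : ℝ) - j|⁻¹ ≤ pairingTerm n j k := by
  wlog hjk : j ≤ k generalizing j k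
  · rw [pairingTerm_symm, abs_sub_comm]
    exact this hk hj (le_of_not_ge hjk)
  rcases hjk.eq_or_lt with rfl | hjk
  · simp [pairingTerm]
  have hn : (0 : ℝ) < n := by exact_mod_cast (Nat.zero_le k).trans_lt hk
  have hd : (0 : ℝ) < (k : ℝ) - j := sub_pos.2 (by exact_mod_cast hjk)
  have s1 := sin_node_add_node_pos j k
  have s2 := sin_pi_mul_div_pos hjk hk
  have p1 := node_pos j
  have p2 := node_pos k
  have h1 := slope_div_three_le (n := n - 1) hjk (by omega)
  have h2 : 2 * Real.sin ((node j + node k) / 2) ≤ node j + node k := by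
    linarith [Real.sin_le (x := (node j + node k) / 2) (by linarith)]
  have h3 : Real.sin (Real.pi * (k - j) / n) ≤ Real.pi * (k - j) / n :=
    Real.sin_le (div_pos (mul_pos Real.pi_pos hd) hn).le
  have h4 : 0 ≤ node j * slope j - node k * slope k := by
    have h5 := (div_pos (slope_pos (n - 1)) three_pos).le.trans h1
    have h6 := mul_nonneg h5 (add_pos p1 p2).le
    rwa [div_mul_cancel₀ _ (add_pos p1 p2).ne'] at h6
  rw [abs_of_pos hd, pairingTerm]
  calc slope (n - 1) / (3 * Real.pi * n) * ((k : ℝ) - j)⁻¹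
      = 1 / (n : ℝ) ^ 2 * (slope (n - 1) / 3 / (Real.pi * (k - j) / n)) := by
        have := Real.pi_pos
        field_simp
    _ ≤ 1 / (n : ℝ) ^ 2 * ((node j * slope j - node k * slope k) / (node j + node k) /
          (Real.pi * (k - j) / n)) := by
        gcongr
    _ = 1 / (n : ℝ) ^ 2 * ((node j * slope j - node k * slope k) /
          ((node j + node k) * (Real.pi * (k - j) / n))) := by rw [div_div]
    _ ≤ _ := by gcongr

theorem le_sum_pairingTerm {n : ℕ} (hn : 3 ≤ n) :
    1 / (3 * Real.pi * √2) * √(Real.log n) ≤ ∑ j : Fin n, ∑ k : Fin n, pairingTerm n j k := by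
  have hn0 : (3 : ℝ) ≤ n := by exact_mod_cast hn
  have hlog : 0 < Real.log n := Real.log_pos (by linarith)
  have hs : (√2 * √(Real.log n))⁻¹ ≤ slope (n - 1) := by
    have e : ((n - 1 : ℕ) : ℝ) + 2 = n + 1 := by
      rw [Nat.cast_sub (by omega)]; push_cast; ring
    rw [slope, e, Real.rpow_neg (Real.log_nonneg (by linarith)), ← Real.sqrt_eq_rpow,
      ← Real.sqrt_mul (by norm_num)]
    have h1 : Real.log (n + 1) ≤ 2 * Real.log n := by
      have h2 : Real.log ((n : ℝ) ^ 2) = 2 * Real.log n := by simp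
      rw [← h2]
      exact Real.log_le_log (by linarith) (by nlinarith)
    have h0 : 0 < Real.log ((n : ℝ) + 1) := Real.log_pos (by linarith)
    gcongr
  have h1 : ∀ j : Fin n, slope (n - 1) / (3 * Real.pi * n) * Real.log n ≤
      ∑ k : Fin n, pairingTerm n j k := by
    intro j
    calc slope (n - 1) / (3 * Real.pi * n) * Real.log n
        ≤ slope (n - 1) / (3 * Real.pi * n) * ∑ k : Fin n, |((k : ℕ) : ℝ) - (j : ℕ)|⁻¹ := by
          refine mul_le_mul_of_nonneg_left ?_ ?_
          · rw [← Finset.sum_range fun k : ℕ => |(k : ℝ) - (j : ℕ)|⁻¹]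
            exact log_le_sum_inv_abs_sub j.isLt
          · have := slope_pos (n - 1)
            have := Real.pi_pos
            positivity
      _ ≤ _ := by
          rw [Finset.mul_sum]
          exact Finset.sum_le_sum fun k _ => le_pairingTerm j.isLt k.isLt
  calc 1 / (3 * Real.pi * √2) * √(Real.log n)
      = (√2 * √(Real.log n))⁻¹ / (3 * Real.pi) * (√(Real.log n) * √(Real.log n)) := by
        have := Real.sqrt_pos.2 hlog
        field_simp
    _ = (√2 * √(Real.log n))⁻¹ / (3 * Real.pi) * Real.log n := by
        rw [Real.mul_self_sqrt hlog.le]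
    _ ≤ slope (n - 1) / (3 * Real.pi) * Real.log n := by
        have := Real.pi_pos
        gcongr
    _ = ∑ _j : Fin n, slope (n - 1) / (3 * Real.pi * n) * Real.log n := by
        rw [Finset.sum_const, Finset.card_univ, Fintype.card_fin, nsmul_eq_mul]
        have : (n : ℝ) ≠ 0 := by linarith
        have := Real.pi_pos
        field_simp
    _ ≤ _ := Finset.sum_le_sum fun j _ => h1 j


theorem conj_exp_mul_I (t : ℝ) :
    (starRingEnd ℂ) (Complex.exp (t * Complex.I)) = Complex.exp ((-t : ℝ) * Complex.I) := by
  rw [← Complex.exp_conj]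
  simp

theorem norm_inv_sqrt_mul_exp {n : ℕ} (t : ℝ) :
    ‖((√n)⁻¹ : ℂ) * Complex.exp (t * Complex.I)‖ ^ 2 = (n : ℝ)⁻¹ := by
  rw [norm_mul, Complex.norm_exp_ofReal_mul_I, mul_one, norm_inv, Complex.norm_real,
    Real.norm_of_nonneg (Real.sqrt_nonneg _), inv_pow, Real.sq_sqrt (Nat.cast_nonneg _)]

/-- The entries of the unitary matrix of the discrete Fourier transform. -/
def fourierEntry (n : ℕ) (l j : ℕ) : ℂ :=
  ((√n)⁻¹ : ℂ) * Complex.exp ((2 * Real.pi * l * j / n : ℝ) * Complex.I)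

theorem fourierEntry_comm (n l j : ℕ) : fourierEntry n l j = fourierEntry n j l := by
  rw [fourierEntry, fourierEntry, mul_right_comm (2 * Real.pi)]

/-- The root of unity `e^{2πi(k-j)/n}`. -/
def unityRoot (n j k : ℕ) : ℂ := Complex.exp ((2 * Real.pi * (k - j) / n : ℝ) * Complex.I)

theorem conj_fourierEntry_mul {n : ℕ} (l j k : ℕ) :
    (starRingEnd ℂ) (fourierEntry n l j) * fourierEntry n l k =
      (n : ℂ)⁻¹ * unityRoot n j k ^ l := by
  rw [fourierEntry, fourierEntry, map_mul, conj_exp_mul_I, unityRoot, ← Complex.exp_nat_mul]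
  have h1 : (starRingEnd ℂ) ((√n : ℂ)⁻¹) * (√n : ℂ)⁻¹ = (n : ℂ)⁻¹ := by
    rw [map_inv₀, Complex.conj_ofReal, ← mul_inv, ← Complex.ofReal_mul,
      Real.mul_self_sqrt (Nat.cast_nonneg _), Complex.ofReal_natCast]
  rw [mul_mul_mul_comm, h1, ← Complex.exp_add]
  congr 2
  push_cast
  ring

theorem unityRoot_pow {n : ℕ} (hn : n ≠ 0) (j k : ℕ) : unityRoot n j k ^ n = 1 := by
  rw [unityRoot, ← Complex.exp_nat_mul, Complex.exp_eq_one_iff]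
  refine ⟨(k : ℤ) - j, ?_⟩
  have : (n : ℂ) ≠ 0 := Nat.cast_ne_zero.2 hn
  push_cast
  field_simp

theorem sin_pi_mul_div_ne_zero {n j k : ℕ} (hjk : j ≠ k) (hj : j < n) (hk : k < n) :
    Real.sin (Real.pi * (k - j) / n) ≠ 0 := by
  rcases hjk.lt_or_gt with h | h
  · exact (sin_pi_mul_div_pos h hk).ne'
  · have e : Real.pi * ((k : ℝ) - j) / n = -(Real.pi * (j - k) / n) := by ring
    rw [e, Real.sin_neg]
    exact neg_ne_zero.2 (sin_pi_mul_div_pos h hj).ne'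

theorem unityRoot_sub_one (n j k : ℕ) :
    unityRoot n j k - 1 = Complex.exp ((Real.pi * (k - j) / n : ℝ) * Complex.I) *
      (2 * Complex.I * (Real.sin (Real.pi * (k - j) / n) : ℂ)) := by
  have h := exp_mul_I_sub_exp_mul_I (2 * Real.pi * (k - j) / n) 0
  rw [Complex.ofReal_zero, zero_mul, Complex.exp_zero, add_zero, sub_zero] at h
  have e : 2 * Real.pi * ((k : ℝ) - j) / n / 2 = Real.pi * (k - j) / n := by ring
  rw [e] at h
  exact h

theorem unityRoot_ne_one {n j k : ℕ} (hjk : j ≠ k) (hj : j < n) (hk : k < n) :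
    unityRoot n j k ≠ 1 := by
  rw [← sub_ne_zero, unityRoot_sub_one]
  exact mul_ne_zero (Complex.exp_ne_zero _) (mul_ne_zero (by simp)
    (Complex.ofReal_ne_zero.2 (sin_pi_mul_div_ne_zero hjk hj hk)))

theorem geom_sum_eq_zero_of_pow_eq_one {r : ℂ} {n : ℕ} (hr : r ≠ 1) (hn : r ^ n = 1) :
    ∑ l ∈ Finset.range n, r ^ l = 0 := by
  rw [geom_sum_eq hr, hn, sub_self, zero_div]

theorem sub_one_mul_sum_natCast_mul_pow (r : ℂ) (n : ℕ) :
    (r - 1) * ∑ l ∈ Finset.range n, (l : ℂ) * r ^ l =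
      n * r ^ n - r * ∑ l ∈ Finset.range n, r ^ l := by
  induction n with
  | zero => simp
  | succ n ih =>
    rw [Finset.sum_range_succ, mul_add, ih, Finset.sum_range_succ]
    push_cast
    ring

theorem orthonormal_fourier_combination {N n : ℕ} (hn : n ≠ 0) {e : Fin n → Ell2 N}
    (he : Orthonormal ℂ e) :
    Orthonormal ℂ fun l : Fin n => ∑ j : Fin n, fourierEntry n l j • e j := by
  classical
  rw [orthonormal_iff_ite]
  intro l m
  rw [he.inner_sum]
  have h1 : ∀ j : Fin n, (starRingEnd ℂ) (fourierEntry n l j) * fourierEntry n m j =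
      (n : ℂ)⁻¹ * unityRoot n l m ^ (j : ℕ) := by
    intro j
    rw [fourierEntry_comm n l, fourierEntry_comm n m, conj_fourierEntry_mul]
  simp only [h1]
  rw [← Finset.mul_sum, ← Finset.sum_range fun j => unityRoot n l m ^ j]
  have hn' : (n : ℂ) ≠ 0 := Nat.cast_ne_zero.2 hn
  split_ifs with h
  · subst h
    simp [unityRoot, hn']
  · rw [geom_sum_eq_zero_of_pow_eq_one (unityRoot_ne_one (fun h' => h (Fin.ext h')) l.isLt m.isLt)
      (unityRoot_pow hn _ _), mul_zero]

/-- A discrete sawtooth with values in `[-1, 1]`. -/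
def sawtooth (n l : ℕ) : ℝ := (2 * l - (n - 1)) / n

theorem norm_sawtooth_le {n l : ℕ} (hl : l < n) : ‖(sawtooth n l : ℂ)‖ ≤ 1 := by
  have hn : (0 : ℝ) < n := by exact_mod_cast (Nat.zero_le l).trans_lt hl
  have h0 : (0 : ℝ) ≤ l := Nat.cast_nonneg l
  have h1 : (l : ℝ) + 1 ≤ n := by exact_mod_cast hl
  rw [Complex.norm_real, Real.norm_eq_abs, sawtooth, abs_div, abs_of_pos hn, div_le_one hn, abs_le]
  constructor <;> linarith

/-- The Fourier multiplier with symbol `sawtooth` is a discrete Hilbert transform. -/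
theorem sum_sawtooth_mul_fourierEntry {n j k : ℕ} (hjk : j ≠ k) (hj : j < n) (hk : k < n) :
    ∑ l : Fin n, (sawtooth n l : ℂ) *
      ((starRingEnd ℂ) (fourierEntry n l j) * fourierEntry n l k) =
      (n : ℂ)⁻¹ * (Complex.exp ((-(Real.pi * (k - j) / n) : ℝ) * Complex.I) /
        (Complex.I * (Real.sin (Real.pi * (k - j) / n) : ℂ))) := by
  have hn : n ≠ 0 := by omega
  have hn' : (n : ℂ) ≠ 0 := Nat.cast_ne_zero.2 hn
  set r := unityRoot n j k with hr
  have hr1 : r - 1 ≠ 0 := sub_ne_zero.2 (unityRoot_ne_one hjk hj hk)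
  have hg : ∑ l ∈ Finset.range n, r ^ l = 0 :=
    geom_sum_eq_zero_of_pow_eq_one (unityRoot_ne_one hjk hj hk) (unityRoot_pow hn _ _)
  have hw : ∑ l ∈ Finset.range n, (l : ℂ) * r ^ l = n / (r - 1) := by
    rw [eq_div_iff hr1, mul_comm, sub_one_mul_sum_natCast_mul_pow, hg, hr, unityRoot_pow hn]
    ring
  simp only [conj_fourierEntry_mul]
  rw [← hr, ← Finset.sum_range fun l => (sawtooth n l : ℂ) * ((n : ℂ)⁻¹ * r ^ l)]
  have h1 : ∀ l ∈ Finset.range n, (sawtooth n l : ℂ) * ((n : ℂ)⁻¹ * r ^ l) =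
      2 / (n : ℂ) ^ 2 * (l * r ^ l) - (n - 1) / (n : ℂ) ^ 2 * r ^ l := by
    intro l _
    rw [sawtooth]
    push_cast
    field_simp
  rw [Finset.sum_congr rfl h1, Finset.sum_sub_distrib, ← Finset.mul_sum, ← Finset.mul_sum, hg, hw,
    mul_zero, sub_zero, hr, unityRoot_sub_one, Complex.ofReal_neg, neg_mul, Complex.exp_neg]
  have hs : (Real.sin (Real.pi * (k - j) / n) : ℂ) ≠ 0 :=
    Complex.ofReal_ne_zero.2 (sin_pi_mul_div_ne_zero hjk hj hk)
  have he := Complex.exp_ne_zero ((Real.pi * (k - j) / n : ℝ) * Complex.I)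
  have hI := Complex.I_ne_zero
  generalize (Real.sin (Real.pi * (k - j) / n) : ℂ) = s at *
  generalize Complex.exp ((Real.pi * (k - j) / n : ℝ) * Complex.I) = w at *
  field_simp

/-- The diagonal operator with the given eigenvalues. -/
def diagOp {N : ℕ} (z : Fin N → ℂ) : Op N :=
  Matrix.toEuclideanCLM (n := Fin N) (𝕜 := ℂ) (Matrix.diagonal z)

theorem diagOp_apply_basisFun {N : ℕ} (z : Fin N → ℂ) (i : Fin N) :
    diagOp z (EuclideanSpace.basisFun (Fin N) ℂ i) =
      z i • EuclideanSpace.basisFun (Fin N) ℂ i := by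
  ext k
  rw [diagOp, Matrix.ofLp_toEuclideanCLM, Matrix.mulVec_diagonal]
  rcases eq_or_ne k i with rfl | h
  · simp
  · simp [h]

theorem diagOp_mem_unitary {N : ℕ} {z : Fin N → ℂ} (hz : ∀ i, ‖z i‖ = 1) :
    diagOp z ∈ unitary (Op N) := by
  have h1 : ∀ i, (starRingEnd ℂ) (z i) * z i = 1 := by
    intro i
    rw [Complex.conj_mul', hz i]
    simp
  rw [Unitary.mem_iff, diagOp, ← map_star, ← map_mul, ← map_mul, Matrix.star_eq_conjTranspose,
    Matrix.diagonal_conjTranspose, Matrix.diagonal_mul_diagonal, Matrix.diagonal_mul_diagonal]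
  have h2 : (Matrix.diagonal fun i => star z i * z i) = 1 := by
    rw [← Matrix.diagonal_one]
    congr 1
    funext i
    exact h1 i
  have h3 : (Matrix.diagonal fun i => z i * star z i) = 1 := by
    rw [← h2]
    congr 1
    funext i
    exact mul_comm _ _
  rw [h2, h3, map_one]
  exact ⟨rfl, rfl⟩


/-- Unimodular weights, up to the factor `n^{-1/2}`, that make all terms of the trace pairing real
and of the same sign. -/
def phase (n j : ℕ) : ℂ :=
  ((√n)⁻¹ : ℂ) * Complex.exp ((node j / 2 - Real.pi * j / n : ℝ) * Complex.I)

theorem phase_mul_conj_phase (n j k : ℕ) :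
    phase n j * (starRingEnd ℂ) (phase n k) =
      (n : ℂ)⁻¹ * (Complex.exp (((node j + -node k) / 2 : ℝ) * Complex.I) *
        Complex.exp ((Real.pi * (k - j) / n : ℝ) * Complex.I)) := by
  have h1 : (√n : ℂ)⁻¹ * (starRingEnd ℂ) ((√n : ℂ)⁻¹) = (n : ℂ)⁻¹ := by
    rw [map_inv₀, Complex.conj_ofReal, ← mul_inv, ← Complex.ofReal_mul,
      Real.mul_self_sqrt (Nat.cast_nonneg _), Complex.ofReal_natCast]
  rw [phase, phase, map_mul, conj_exp_mul_I, mul_mul_mul_comm, h1, ← Complex.exp_add,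
    ← Complex.exp_add]
  congr 2
  push_cast
  ring

theorem norm_sum_phase_smul {N n : ℕ} (hn : n ≠ 0) {e : Fin n → Ell2 N} (he : Orthonormal ℂ e) :
    ‖∑ j : Fin n, phase n j • e j‖ = 1 := by
  have h1 : ‖∑ j : Fin n, phase n j • e j‖ ^ 2 = 1 := by
    apply Complex.ofReal_injective
    have h2 : ∀ j : Fin n, ‖phase n j‖ ^ 2 = (n : ℝ)⁻¹ := fun j => norm_inv_sqrt_mul_exp _
    have h3 := inner_self_eq_norm_sq_to_K (𝕜 := ℂ) (∑ j : Fin n, phase n j • e j)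
    rw [he.inner_sum] at h3
    rw [Complex.ofReal_pow]
    refine h3.symm.trans ?_
    simp only [Complex.conj_mul', ← Complex.ofReal_pow, h2]
    simp [hn]
  exact (pow_eq_one_iff_of_nonneg (norm_nonneg _) two_ne_zero).1 h1

theorem sum_sawtooth_mul_sigmaFun {h : ℝ → ℝ} (hh : IsPeriodicExtension h) {n j k : ℕ}
    (hj : j < n) (hk : k < n) :
    (∑ l : Fin n, (sawtooth n l : ℂ) *
      ((starRingEnd ℂ) (fourierEntry n l j) * fourierEntry n l k)) *
      (sigmaFun h (Complex.exp ((node j : ℝ) * Complex.I)) 1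
        (Complex.exp ((-node k : ℝ) * Complex.I)) *
        (phase n j * (starRingEnd ℂ) (phase n k))) = -(pairingTerm n j k : ℂ) := by
  have hsin : ∀ i, Real.sin (node i / 2) ≠ 0 := fun i =>
    (Real.sin_pos_of_pos_of_lt_pi (half_pos (node_pos i))
      (by linarith [node_lt_one i, Real.pi_gt_three])).ne'
  have hs := (sin_node_add_node_pos j k).ne'
  rw [sigmaFun_exp_one_exp hh.periodic (hsin j)
    (by rw [neg_div, Real.sin_neg, neg_ne_zero]; exact hsin k) (by rwa [sub_neg_eq_add]),
    apply_of_abs_eq_node hh j (abs_of_pos (node_pos j)),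
    apply_of_abs_eq_node hh k (by rw [abs_neg, abs_of_pos (node_pos k)]),
    sub_neg_eq_add, phase_mul_conj_phase, pairingTerm]
  rcases eq_or_ne j k with rfl | hjk
  · simp
  rw [sum_sawtooth_mul_fourierEntry hjk hj hk, Complex.ofReal_neg (Real.pi * (k - j) / n), neg_mul,
    Complex.exp_neg]
  have hs2 := sin_pi_mul_div_ne_zero hjk hj hk
  have hn' : (n : ℂ) ≠ 0 := Nat.cast_ne_zero.2 (by omega)
  rw [Complex.ofReal_mul, Complex.ofReal_div (_ - _), Complex.ofReal_mul (2 * _),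
    Complex.ofReal_mul 2, Complex.ofReal_div 1, Complex.ofReal_pow, Complex.ofReal_natCast,
    Complex.ofReal_one, Complex.ofReal_ofNat]
  have h1 : (Real.sin ((node j + node k) / 2) : ℂ) ≠ 0 := Complex.ofReal_ne_zero.2 hs
  have h2 : (Real.sin (Real.pi * (k - j) / n) : ℂ) ≠ 0 := Complex.ofReal_ne_zero.2 hs2
  have h3 := Complex.exp_ne_zero (((node j + -node k) / 2 : ℝ) * Complex.I)
  have h4 := Complex.exp_ne_zero ((Real.pi * (k - j) / n : ℝ) * Complex.I)
  have hI := Complex.I_ne_zero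
  generalize (Real.sin ((node j + node k) / 2) : ℂ) = s at *
  generalize (Real.sin (Real.pi * (k - j) / n) : ℂ) = t at *
  generalize Complex.exp (((node j + -node k) / 2 : ℝ) * Complex.I) = v at *
  generalize Complex.exp ((Real.pi * (k - j) / n : ℝ) * Complex.I) = w at *
  generalize ((node j * slope j - node k * slope k : ℝ) : ℂ) = d at *
  field_simp
  rw [Complex.I_sq]
  ring

/-- A lower bound for the norm of the triple operator integral of the diagonal unitary with
eigenvalues `1`, `e^{i a_j}`, `e^{-i a_j}`, where `a_j` are the nodes. -/
theorem sum_pairingTerm_le_bilinNorm {h : ℝ → ℝ} (hh : IsPeriodicExtension h) {N n : ℕ}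
    (hn : n ≠ 0) (θ : Fin N → ℝ) (o : Fin N) (ι κ : Fin n → Fin N)
    (hι : Function.Injective ι) (hκ : Function.Injective κ) (ho : θ o = 0)
    (hθι : ∀ j, θ (ι j) = node j) (hθκ : ∀ k, θ (κ k) = -node k) :
    ENNReal.ofReal (∑ j : Fin n, ∑ k : Fin n, pairingTerm n j k) ≤
      bilinNorm (triple (sigmaFun h) (diagOp fun i => Complex.exp (θ i * Complex.I))
        (diagOp fun i => Complex.exp (θ i * Complex.I))
        (diagOp fun i => Complex.exp (θ i * Complex.I))) := by
  classical
  set z : Fin N → ℂ := fun i => Complex.exp (θ i * Complex.I) with hz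
  set b := EuclideanSpace.basisFun (Fin N) ℂ
  have hbι : Orthonormal ℂ fun j => b (ι j) := b.orthonormal.comp ι hι
  have hbκ : Orthonormal ℂ fun j => b (κ j) := b.orthonormal.comp κ hκ
  set x := ∑ j : Fin n, phase n j • b (ι j)
  set y := ∑ j : Fin n, phase n j • b (κ j)
  set X := InnerProductSpace.rankOne ℂ x (b o)
  set Y := InnerProductSpace.rankOne ℂ (b o) y
  have hX : schattenNorm 2 X ≤ 1 := by
    rw [schattenNorm_two_rankOne, norm_sum_phase_smul hn hbι, b.norm_eq_one, one_mul]
  have hY : schattenNorm 2 Y ≤ 1 := by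
    rw [schattenNorm_two_rankOne, norm_sum_phase_smul hn hbκ, b.norm_eq_one, one_mul]
  refine le_iSup_of_le X (le_iSup_of_le Y (le_iSup_of_le hX (le_iSup_of_le hY ?_)))
  refine ENNReal.ofReal_le_ofReal ?_
  set Z := triple (sigmaFun h) (diagOp z) (diagOp z) (diagOp z) X Y
  have hZ : ∀ j k : Fin n, inner ℂ (b (ι j)) (Z (b (κ k))) =
      sigmaFun h (Complex.exp ((node j : ℝ) * Complex.I)) 1
        (Complex.exp ((-node k : ℝ) * Complex.I)) *
        (phase n j * (starRingEnd ℂ) (phase n k)) := by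
    intro j k
    rw [inner_triple_rankOne (sigmaFun h) (diagOp z) b z (diagOp_apply_basisFun z) x y o,
      hbι.inner_right_fintype, hbκ.inner_left_fintype]
    simp [hz, hθι, hθκ, ho]
  have hdual := norm_sum_inner_le_schattenNorm_one Z _ _
    (orthonormal_fourier_combination hn hbι) (orthonormal_fourier_combination hn hbκ)
    (fun l : Fin n => (sawtooth n l : ℂ)) fun l => norm_sawtooth_le l.isLt
  have hsum : ∑ l : Fin n, (sawtooth n l : ℂ) *
      inner ℂ (∑ j : Fin n, fourierEntry n l j • b (ι j))
        (Z (∑ k : Fin n, fourierEntry n l k • b (κ k))) =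
      ((-∑ j : Fin n, ∑ k : Fin n, pairingTerm n j k : ℝ) : ℂ) := by
    calc _ = ∑ l : Fin n, ∑ j : Fin n, ∑ k : Fin n, (sawtooth n l : ℂ) *
          ((starRingEnd ℂ) (fourierEntry n l j) * fourierEntry n l k) *
            inner ℂ (b (ι j)) (Z (b (κ k))) := by
          refine Finset.sum_congr rfl fun l _ => ?_
          rw [map_sum, sum_inner, Finset.mul_sum]
          refine Finset.sum_congr rfl fun j _ => ?_
          rw [inner_sum, Finset.mul_sum]
          refine Finset.sum_congr rfl fun k _ => ?_
          rw [map_smul, inner_smul_left, inner_smul_right]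
          ring
      _ = ∑ j : Fin n, ∑ k : Fin n, (∑ l : Fin n, (sawtooth n l : ℂ) *
          ((starRingEnd ℂ) (fourierEntry n l j) * fourierEntry n l k)) *
            inner ℂ (b (ι j)) (Z (b (κ k))) := by
          rw [Finset.sum_comm]
          refine Finset.sum_congr rfl fun j _ => ?_
          rw [Finset.sum_comm]
          simp only [Finset.sum_mul]
      _ = _ := by
          simp only [hZ, sum_sawtooth_mul_sigmaFun hh (Fin.isLt _) (Fin.isLt _)]
          push_cast
          simp
  rw [hsum, Complex.norm_real, norm_neg] at hdual
  exact (Real.le_norm_self _).trans hdual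

end TripleOperatorIntegral

end

/- The norm of the triple operator integral is unchanged if its first operator is replaced by a
unitarily equivalent one, so that `K = H` is a sufficient choice. -/
theorem corollary4p5 (h : ℝ → ℝ) (hh : TripleOperatorIntegral.IsPeriodicExtension h) :
    ∃ c : ℝ, 0 < c ∧ ∀ n : ℕ, 3 ≤ n →
      ∃ H K : TripleOperatorIntegral.Op (2 * n + 1),
        H ∈ unitary (TripleOperatorIntegral.Op (2 * n + 1)) ∧
        K ∈ unitary (TripleOperatorIntegral.Op (2 * n + 1)) ∧
        spectrum ℂ H = spectrum ℂ K ∧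
        ENNReal.ofReal (c * Real.sqrt (Real.log n)) ≤
          TripleOperatorIntegral.bilinNorm
            (TripleOperatorIntegral.triple (TripleOperatorIntegral.sigmaFun h) K H H) := by
  have hpi := Real.pi_pos
  refine ⟨1 / (3 * Real.pi * √2), by positivity, fun n hn => ?_⟩
  let θ : Fin (2 * n + 1) → ℝ := fun i =>
    if (i : ℕ) = 0 then 0
    else if (i : ℕ) ≤ n then TripleOperatorIntegral.node (i - 1)
    else -TripleOperatorIntegral.node (i - (n + 1))
  let ι : Fin n → Fin (2 * n + 1) := fun j => ⟨j + 1, by omega⟩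
  let κ : Fin n → Fin (2 * n + 1) := fun j => ⟨n + 1 + j, by omega⟩
  have hu := TripleOperatorIntegral.diagOp_mem_unitary
    (z := fun i => Complex.exp (θ i * Complex.I)) fun i => Complex.norm_exp_ofReal_mul_I _
  refine ⟨_, _, hu, hu, rfl, ?_⟩
  refine (ENNReal.ofReal_le_ofReal (TripleOperatorIntegral.le_sum_pairingTerm hn)).trans
    (TripleOperatorIntegral.sum_pairingTerm_le_bilinNorm hh (by omega) θ ⟨0, by omega⟩ ι κ
      ?_ ?_ ?_ ?_ ?_)
  · intro i j hij
    exact Fin.ext (by simpa [ι] using hij)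
  · intro i j hij
    exact Fin.ext (by simpa [κ] using hij)
  · simp [θ]
  · intro j
    simp [θ, ι, Nat.succ_le_of_lt j.isLt]
  · intro k
    have : ¬ n + 1 + (k : ℕ) ≤ n := by omega
    simp [θ, κ, this]
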